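/- **Theorem 4** (tail bounds for a sum of squared covariance-estimation errors). Let $m,n,p\ge 1$. For $l\in[m]$ and $k\in[n]$ let $X^{(l)}_k$ be random vectors in $\mathbb{R}^p$, all $mn$ of them independent, such that $X^{(l)}_1,\dots,X^{(l)}_n$ have mean zero and common covariance matrix $\Sigma^{(l)}$. Assume that every entry satisfies $\|X^{(l)}_{k,i}\|_{\psi_2}\le 1$, where $\psi_2(x)=e^{x^2}-1$ and $\|Y\|_{g}=\inf\{\eta>0:\mathbb{E}[g(|Y|/\eta)]\le 1\}$. Let $\hat\Sigma^{(l)}=\frac1n\sum_{k=1}^n X^{(l)}_kX^{(l)\top}_k$ and fix $i,j\in[p]$. Put $$S=\sum_{l=1}^m\bigl(\hat\Sigma^{(l)}_{ij}-\Sigma^{(l)}_{ij}\bigr)^2,\qquad r(t)=\min\Bigl\{\frac{n^2t^2}{m},\,nt,\,n\sqrt t\Bigr\}.$$ 1. There are absolute constants $C,c>0$ such that $\mathbb{P}[S\ge t+C\frac mn]\le 4\exp(-c\,r(t))$ for all $t>0$. 2. In equivalent form (up to the values of the constants), there is an absolute constant $C>0$ such that for all $\nu>0$, with probability at least $1-e^{-\nu}$,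 $$S\le C\Bigl(\frac{m+\sqrt{m\nu}+\nu}{n}+\frac{\nu^2}{n^2}\Bigr).$$ 3. Conversely, for all $\kappa,C_0>0$ there are constants $c,C>0$, depending only on $\kappa$ and $C_0$, such that the following holds. If for every $l\in[m]$ $$\mathbb{P}\bigl[|\hat\Sigma^{(l)}_{ij}-\Sigma^{(l)}_{ij}|\ge t\bigr]\ge \kappa\exp\bigl(-C_0\min\{nt,nt^2\}\bigr)\quad\text{for all }t>0,$$ then $\mathbb{P}[S\ge t+c\frac mn]\ge\frac1C\exp(-C\,r(t))$ for all $t>0$. In each part the constants do not depend on $m,n,p,i,j$ or on the distribution of the data. -/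

import Mathlib

open MeasureTheory ProbabilityTheory
open scoped ENNReal

/-- The Orlicz function `ψ_α(x) = exp (x ^ α) - 1`. -/
noncomputable def psi (α : ℝ) (x : ℝ) : ℝ := Real.exp (x ^ α) - 1

/-- The `g`-Orlicz norm `inf {η > 0 : E[g(|Y| / η)] ≤ 1}` of a real random variable, as an
extended nonnegative real; it is `∞` when no `η` is admissible. -/
noncomputable def orliczNorm {Ω : Type*} [MeasurableSpace Ω] (g : ℝ → ℝ) (Y : Ω → ℝ)
    (P : Measure Ω) : ℝ≥0∞ :=
  sInf {r : ℝ≥0∞ | ∃ η : ℝ, 0 < η ∧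
    ∫⁻ ω, ENNReal.ofReal (g (|Y ω| / η)) ∂P ≤ 1 ∧ r = ENNReal.ofReal η}

/-- `X l k` is the `k`-th observation of the `l`-th group of `p`-dimensional random vectors.
All observations (within and across groups) are independent; those of group `l` have mean zero
and covariance matrix `S l`, and every entry has `ψ₂`-Orlicz norm at most `1`. -/
structure IsSubGaussianSample {Ω : Type*} [MeasurableSpace Ω] (P : Measure Ω) {m n p : ℕ}
    (X : Fin m → Fin n → Ω → (Fin p → ℝ)) (S : Fin m → Matrix (Fin p) (Fin p) ℝ) : Prop where
  measurable : ∀ l k, Measurable (X l k)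
  indep : iIndepFun (fun (q : Fin m × Fin n) => X q.1 q.2) P
  mean_zero : ∀ l k i, ∫ ω, X l k ω i ∂P = 0
  covariance_eq : ∀ l k i j,
    covariance (fun ω => X l k ω i) (fun ω => X l k ω j) P = S l i j
  orlicz_le_one : ∀ l k i, orliczNorm (psi 2) (fun ω => X l k ω i) P ≤ 1

/-- The empirical covariance matrix `(1 / n) ∑ₖ xₖ xₖᵀ`. -/
noncomputable def empCov {n p : ℕ} (x : Fin n → (Fin p → ℝ)) : Matrix (Fin p) (Fin p) ℝ :=
  (1 / (n : ℝ)) • ∑ k, Matrix.vecMulVec (x k) (x k)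

/-- The estimation error of the `(i, j)` entry of the covariance matrix of group `l`. -/
noncomputable def covErr {Ω : Type*} {m n p : ℕ} (X : Fin m → Fin n → Ω → (Fin p → ℝ))
    (S : Fin m → Matrix (Fin p) (Fin p) ℝ) (i j : Fin p) (l : Fin m) (ω : Ω) : ℝ :=
  empCov (fun k => X l k ω) i j - S l i j

/-- The sum over the groups of the squared estimation errors of the `(i, j)` entry. -/
noncomputable def sumSqErr {Ω : Type*} {m n p : ℕ} (X : Fin m → Fin n → Ω → (Fin p → ℝ))
    (S : Fin m → Matrix (Fin p) (Fin p) ℝ) (i j : Fin p) (ω : Ω) : ℝ :=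
  ∑ l, covErr X S i j l ω ^ 2

/-- The exponent `min {n² t² / m, n t, n √t}`. -/
noncomputable def tailRate (m n : ℕ) (t : ℝ) : ℝ :=
  min ((n : ℝ) ^ 2 * t ^ 2 / m) (min (n * t) (n * Real.sqrt t))

/-! Write Z_l for the error in group l. Products of sub-Gaussian entries are subexponential, so Z_l,
a mean of n independent centred products, has the Bernstein tail 2 exp(-c n min(s, s²))
(`measureReal_abs_covErr_ge_le`).

For the upper bounds let t be at least of order m/n and ρ = n min(t, √t). A union bound handles the
event that some |Z_l| is at least √t: its factor m is absorbed since m is at most of order ρ², hence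
at most exp(cρ/2). On the complement each Z_l² equals its truncation at t, whose exponential moment
at a = cρ/(4t) is at most exp(O(a/n)), so Chernoff gives exp(-cρ/4) (`mgf_truncated_sq_le`,
`measureReal_sum_sq_ge_le`). The shift C m/n keeps the level in this range, so the quadratic branch
of the rate is never needed: the rate is at most ρ. The same estimate at a level adapted to ν gives
the second part.

For the lower bound there are two regimes. If t is below a small multiple of m/n, a positive
proportion of the |Z_l| exceeds 1/√n with positive probability, by a first-moment argument
(`half_le_measureReal_of_count_le`). Otherwise a single Z_l with Z_l² ≥ 2t suffices, and the rate is
comparable to n min(t, √t). -/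

/-- Grouping the members of an independent family indexed by a product yields an independent
family of vectors. -/
theorem iIndepFun_curry {Ω ι κ β : Type*} [MeasurableSpace Ω] [MeasurableSpace β] {P : Measure Ω}
    {X : ι → κ → Ω → β} (mX : ∀ i j, Measurable (X i j))
    (h : iIndepFun (fun (q : ι × κ) => X q.1 q.2) P) :
    iIndepFun (fun i ω j => X i j ω) P := by
  have := h.isProbabilityMeasure
  have hσ : iIndepFun (fun (q : (_ : ι) × κ) => X q.1 q.2) P :=
    h.precomp (g := Equiv.sigmaEquivProd ι κ) (Equiv.injective _)
  have hrow : ∀ i, iIndepFun (X i) P := fun i =>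
    h.precomp (g := fun j => (i, j)) (fun a b hab => (Prod.mk.inj hab).2)
  have : ∀ i j, IsProbabilityMeasure (P.map (X i j)) :=
    fun i j => Measure.isProbabilityMeasure_map (mX i j).aemeasurable
  have : ∀ i, IsProbabilityMeasure (P.map (fun ω => (X i · ω))) :=
    fun i => Measure.isProbabilityMeasure_map (Measurable.aemeasurable (by fun_prop))
  have hc : (MeasurableEquiv.piCurry (fun (_ : ι) (_ : κ) => β)) ∘
      (fun ω (q : (_ : ι) × κ) => X q.1 q.2 ω) = fun ω i j => X i j ω := by
    ext; simp [Sigma.curry]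
  rw [iIndepFun_iff_map_fun_eq_infinitePi_map (by fun_prop), ← hc,
    ← Measure.map_map (by fun_prop) (by fun_prop),
    (iIndepFun_iff_map_fun_eq_infinitePi_map (by fun_prop)).1 hσ,
    Measure.infinitePi_map_piCurry (fun i j => P.map (X i j))]
  congrm Measure.infinitePi fun i => ?_
  exact ((iIndepFun_iff_map_fun_eq_infinitePi_map (by fun_prop)).1 (hrow i)).symm

/-! ### Exponential moments from Orlicz norms -/

theorem integrable_of_lintegral_le {Ω : Type*} [MeasurableSpace Ω] {P : Measure Ω} {f : Ω → ℝ}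
    (hf : Measurable f) (h0 : ∀ ω, 0 ≤ f ω) {K : ℝ} (hK : 0 ≤ K)
    (h : ∫⁻ ω, ENNReal.ofReal (f ω) ∂P ≤ ENNReal.ofReal K) :
    Integrable f P ∧ ∫ ω, f ω ∂P ≤ K := by
  refine ⟨(lintegral_ofReal_ne_top_iff_integrable hf.aestronglyMeasurable
    (Filter.Eventually.of_forall h0)).1 (h.trans_lt ENNReal.ofReal_lt_top).ne, ?_⟩
  rw [integral_eq_lintegral_of_nonneg_ae (Filter.Eventually.of_forall h0) hf.aestronglyMeasurable]
  exact ENNReal.toReal_le_of_le_ofReal hK h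

theorem integral_exp_sq_le_of_orliczNorm_le_one {Ω : Type*} [MeasurableSpace Ω] {P : Measure Ω}
    [IsProbabilityMeasure P] {Y : Ω → ℝ} (hY : Measurable Y) (h : orliczNorm (psi 2) Y P ≤ 1) :
    Integrable (fun ω => Real.exp (Y ω ^ 2 / 2)) P ∧ ∫ ω, Real.exp (Y ω ^ 2 / 2) ∂P ≤ 2 := by
  refine integrable_of_lintegral_le (by fun_prop) (fun ω => (Real.exp_pos _).le) (by norm_num) ?_
  -- The infimum bound only provides admissible η slightly above 1; any η < 1.4 works because 1.4² <
  -- 2.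
  have h2 : orliczNorm (psi 2) Y P < ENNReal.ofReal (1.4 : ℝ) :=
    h.trans_lt (ENNReal.one_lt_ofReal.2 (by norm_num))
  obtain ⟨r, ⟨η, hη, hint, rfl⟩, hr⟩ := sInf_lt_iff.1 h2
  have hη2 : η < 1.4 := (ENNReal.ofReal_lt_ofReal_iff (by norm_num)).1 hr
  calc ∫⁻ ω, ENNReal.ofReal (Real.exp (Y ω ^ 2 / 2)) ∂P
      ≤ ∫⁻ ω, (ENNReal.ofReal (psi 2 (|Y ω| / η)) + 1) ∂P := by
        refine lintegral_mono fun ω => ?_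
        rw [← ENNReal.ofReal_one, ← ENNReal.ofReal_add _ zero_le_one]
        · refine ENNReal.ofReal_le_ofReal ?_
          simp only [psi, sub_add_cancel, Real.rpow_ofNat, div_pow, sq_abs]
          gcongr
          nlinarith
        · simp only [psi, sub_nonneg, Real.one_le_exp_iff]
          positivity
    _ = ∫⁻ ω, ENNReal.ofReal (psi 2 (|Y ω| / η)) ∂P + 1 := by
        rw [lintegral_add_right _ measurable_const]; simp
    _ ≤ 1 + 1 := by gcongr
    _ = ENNReal.ofReal 2 := by
      rw [one_add_one_eq_two]; simp

/-- AM-GM twice: on |UV| in the exponent, then on the resulting product of exponentials. No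
independence of the two factors is needed. -/
theorem integral_exp_abs_mul_le {Ω : Type*} [MeasurableSpace Ω] {P : Measure Ω}
    {U V : Ω → ℝ} (hU : Measurable U) (hV : Measurable V)
    (iU : Integrable (fun ω => Real.exp (U ω ^ 2 / 2)) P)
    (bU : ∫ ω, Real.exp (U ω ^ 2 / 2) ∂P ≤ 2)
    (iV : Integrable (fun ω => Real.exp (V ω ^ 2 / 2)) P)
    (bV : ∫ ω, Real.exp (V ω ^ 2 / 2) ∂P ≤ 2) :
    Integrable (fun ω => Real.exp (|U ω * V ω| / 2)) P ∧
      ∫ ω, Real.exp (|U ω * V ω| / 2) ∂P ≤ 2 := by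
  have key : ∀ ω, Real.exp (|U ω * V ω| / 2)
      ≤ (Real.exp (U ω ^ 2 / 2) + Real.exp (V ω ^ 2 / 2)) / 2 := by
    intro ω
    have h1 : |U ω * V ω| / 2 ≤ U ω ^ 2 / 4 + V ω ^ 2 / 4 := by
      rw [abs_mul, ← sq_abs (U ω), ← sq_abs (V ω)]
      nlinarith [sq_nonneg (|U ω| - |V ω|)]
    have hu : Real.exp (U ω ^ 2 / 2) = Real.exp (U ω ^ 2 / 4) ^ 2 := by
      rw [← Real.exp_nat_mul]; congr 1; push_cast; ring
    have hv : Real.exp (V ω ^ 2 / 2) = Real.exp (V ω ^ 2 / 4) ^ 2 := by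
      rw [← Real.exp_nat_mul]; congr 1; push_cast; ring
    refine (Real.exp_le_exp.2 h1).trans ?_
    rw [Real.exp_add, hu, hv]
    nlinarith [sq_nonneg (Real.exp (U ω ^ 2 / 4) - Real.exp (V ω ^ 2 / 4))]
  have hi : Integrable (fun ω => (Real.exp (U ω ^ 2 / 2) + Real.exp (V ω ^ 2 / 2)) / 2) P :=
    (iU.add iV).div_const 2
  have hi' : Integrable (fun ω => Real.exp (|U ω * V ω| / 2)) P := by
    refine hi.mono' (Measurable.aestronglyMeasurable (by fun_prop))
      (Filter.Eventually.of_forall fun ω => ?_)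
    rw [Real.norm_of_nonneg (Real.exp_pos _).le]
    exact key ω
  refine ⟨hi', (integral_mono hi' hi key).trans ?_⟩
  rw [integral_div, integral_add iU iV]
  linarith

/-! ### Bernstein's inequality -/

theorem exp_le_one_add_add_sq_mul_exp_abs (x : ℝ) :
    Real.exp x ≤ 1 + x + x ^ 2 * Real.exp |x| := by
  have h := Complex.norm_exp_sub_sum_le_norm_mul_exp (x : ℂ) 2
  rw [← Complex.ofReal_exp] at h
  simp only [Finset.sum_range_succ, Finset.sum_range_zero, pow_zero, pow_one, Nat.factorial_zero,
    Nat.factorial_one, Nat.cast_one, div_one, zero_add, Complex.norm_real] at h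
  rw [← Complex.ofReal_one, ← Complex.ofReal_add, ← Complex.ofReal_sub, Complex.norm_real,
    Real.norm_eq_abs, Real.norm_eq_abs, sq_abs] at h
  linarith [le_abs_self (Real.exp x - (1 + x))]

theorem sq_div_two_le_exp {x : ℝ} (hx : 0 ≤ x) : x ^ 2 / 2 ≤ Real.exp x := by
  have := Real.quadratic_le_exp_of_nonneg hx
  linarith

/-- In the second-order expansion of the exponential the linear term integrates to zero by centring.
For |a| ≤ 1/4 the remainder, polynomial factor included, is absorbed by exp(|W|/2). -/
theorem mgf_sub_integral_le {Ω : Type*} [MeasurableSpace Ω] {P : Measure Ω}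
    [IsProbabilityMeasure P] {W : Ω → ℝ} (hW : Measurable W)
    (iW : Integrable (fun ω => Real.exp (|W ω| / 2)) P)
    (bW : ∫ ω, Real.exp (|W ω| / 2) ∂P ≤ 2) {a : ℝ} (ha : |a| ≤ 1 / 4) :
    Integrable (fun ω => Real.exp (a * (W ω - ∫ ω', W ω' ∂P))) P ∧
      mgf (fun ω => W ω - ∫ ω', W ω' ∂P) P a ≤ Real.exp (200 * a ^ 2) := by
  have habs : ∀ ω, |W ω| ≤ 2 * Real.exp (|W ω| / 2) - 2 := fun ω => by
    linarith [Real.add_one_le_exp (|W ω| / 2)]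
  have iW0 : Integrable W P := by
    refine ((iW.const_mul 2).sub (integrable_const 2)).mono' hW.aestronglyMeasurable
      (Filter.Eventually.of_forall habs)
  have hμ : |∫ ω', W ω' ∂P| ≤ 2 := by
    refine abs_integral_le_integral_abs.trans ((integral_mono iW0.abs
      ((iW.const_mul 2).sub (integrable_const 2)) habs).trans ?_)
    simp only [Pi.sub_apply]
    rw [integral_sub (iW.const_mul 2) (integrable_const 2), integral_const_mul]
    simp; linarith
  set μ := ∫ ω', W ω' ∂P with hμdef
  have key : ∀ ω, Real.exp (a * (W ω - μ)) ≤
      1 + a * (W ω - μ) + a ^ 2 * (96 * Real.exp (|W ω| / 2)) := by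
    intro ω
    have h1 := exp_le_one_add_add_sq_mul_exp_abs (a * (W ω - μ))
    set y := W ω - μ with hy
    have hyW : |y| ≤ |W ω| + 2 := by
      have := abs_sub (W ω) μ
      linarith
    have h2 : |a * y| ≤ |y| / 4 := by
      rw [abs_mul]; nlinarith [abs_nonneg y]
    have h3 : y ^ 2 ≤ 32 * Real.exp (|y| / 4) := by
      have := sq_div_two_le_exp (x := |y| / 4) (by positivity)
      rw [div_pow, sq_abs] at this
      linarith
    have h4 : y ^ 2 * Real.exp |a * y| ≤ 96 * Real.exp (|W ω| / 2) := by
      calc y ^ 2 * Real.exp |a * y| ≤ 32 * Real.exp (|y| / 4) * Real.exp (|y| / 4) := by gcongr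
        _ = 32 * Real.exp (|y| / 2) := by
          rw [mul_assoc, ← Real.exp_add]; congr 2; ring
        _ ≤ 32 * Real.exp (|W ω| / 2 + 1) := by gcongr; linarith
        _ = 32 * Real.exp 1 * Real.exp (|W ω| / 2) := by rw [Real.exp_add]; ring
        _ ≤ 96 * Real.exp (|W ω| / 2) := by
          gcongr
          linarith [Real.exp_one_lt_d9]
    have h5 : (a * y) ^ 2 * Real.exp |a * y| ≤ a ^ 2 * (96 * Real.exp (|W ω| / 2)) := by
      rw [mul_pow, mul_assoc]; gcongr
    linarith
  have i1 : Integrable (fun ω => 1 + a * (W ω - μ)) P :=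
    (integrable_const _).add ((iW0.sub (integrable_const _)).const_mul a)
  have i2 : Integrable (fun ω => a ^ 2 * (96 * Real.exp (|W ω| / 2))) P :=
    (iW.const_mul 96).const_mul _
  have hi : Integrable (fun ω => Real.exp (a * (W ω - μ))) P := by
    refine (i1.add i2).mono' (Measurable.aestronglyMeasurable (by fun_prop))
      (Filter.Eventually.of_forall fun ω => ?_)
    rw [Real.norm_of_nonneg (Real.exp_pos _).le]
    exact key ω
  refine ⟨hi, ?_⟩
  have h6 : ∫ ω, (1 + a * (W ω - μ)) ∂P = 1 := by
    have i3 : Integrable (fun ω => a * (W ω - μ)) P :=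
      (iW0.sub (integrable_const _)).const_mul a
    rw [integral_add (integrable_const _) i3, integral_const_mul, integral_sub iW0 (integrable_const _)]
    simp [hμdef]
  calc mgf (fun ω => W ω - μ) P a
      ≤ ∫ ω, (1 + a * (W ω - μ) + a ^ 2 * (96 * Real.exp (|W ω| / 2))) ∂P :=
        integral_mono hi (i1.add i2) key
    _ = 1 + a ^ 2 * (96 * ∫ ω, Real.exp (|W ω| / 2) ∂P) := by
        rw [integral_add i1 i2, h6, integral_const_mul, integral_const_mul]
    _ ≤ 1 + 200 * a ^ 2 := by nlinarith [sq_nonneg a]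
    _ ≤ Real.exp (200 * a ^ 2) := by linarith [Real.add_one_le_exp (200 * a ^ 2)]

theorem measureReal_sum_ge_le_of_mgf_le {Ω : Type*} [MeasurableSpace Ω] {P : Measure Ω}
    [IsProbabilityMeasure P] {n : ℕ} {Y : Fin n → Ω → ℝ} (hY : ∀ k, Measurable (Y k))
    (hind : iIndepFun Y P) {a B : ℝ} (ha : 0 ≤ a)
    (hi : ∀ k, Integrable (fun ω => Real.exp (a * Y k ω)) P)
    (hmgf : ∀ k, mgf (Y k) P a ≤ Real.exp B) (r : ℝ) :
    P.real {ω | r ≤ ∑ k, Y k ω} ≤ Real.exp (n * B - a * r) := by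
  have hsum : Integrable (fun ω => Real.exp (a * (∑ k, Y k) ω)) P :=
    hind.integrable_exp_mul_sum hY (fun k _ => hi k)
  have h := measure_ge_le_exp_mul_mgf r ha hsum
  simp only [Finset.sum_apply] at h
  refine h.trans ?_
  rw [hind.mgf_sum hY, Real.exp_sub, Real.exp_nat_mul, div_eq_mul_inv, ← Real.exp_neg, mul_comm,
    neg_mul]
  gcongr
  refine (Finset.prod_le_prod (fun k _ => mgf_nonneg) (fun k _ => hmgf k)).trans ?_
  simp

/-- Bernstein's inequality for a mean of independent variables with quadratically bounded
logarithmic moment generating functions near the origin. -/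
theorem measureReal_abs_mean_ge_le {Ω : Type*} [MeasurableSpace Ω] {P : Measure Ω}
    [IsProbabilityMeasure P] {n : ℕ} (hn : 0 < n) {Y : Fin n → Ω → ℝ}
    (hY : ∀ k, Measurable (Y k)) (hind : iIndepFun Y P)
    (hmgf : ∀ k (a : ℝ), |a| ≤ 1 / 4 → Integrable (fun ω => Real.exp (a * Y k ω)) P ∧
      mgf (Y k) P a ≤ Real.exp (200 * a ^ 2)) {s : ℝ} (hs : 0 < s) :
    P.real {ω | s ≤ |(1 / (n : ℝ)) * ∑ k, Y k ω|}
      ≤ 2 * Real.exp (-(1 / 800 * n * min s (s ^ 2))) := by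
  have hn' : (0 : ℝ) < n := by exact_mod_cast hn
  -- The minimiser of 200a² - as is s/400; capping s at 1 keeps a ≤ 1/4.
  set a : ℝ := min s 1 / 400 with ha
  have hmin0 : 0 < min s 1 := lt_min hs one_pos
  have hmin1 : min s 1 ≤ 1 := min_le_right _ _
  have hmins : min s 1 ≤ s := min_le_left _ _
  have ha0 : 0 < a := by positivity
  have ha4 : |a| ≤ 1 / 4 := by rw [abs_of_pos ha0]; linarith
  have hmul : min s (s ^ 2) = min s 1 * s := by
    rw [min_mul_of_nonneg _ _ hs.le, min_comm, one_mul, sq]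
  have hexp : n * (200 * a ^ 2) - a * (n * s) ≤ -(1 / 800 * n * min s (s ^ 2)) := by
    rw [hmul, ha]
    nlinarith [mul_nonneg hn'.le (mul_nonneg hmin0.le (sub_nonneg.2 hmins))]
  have h1 := (measureReal_sum_ge_le_of_mgf_le hY hind ha0.le (fun k => (hmgf k a ha4).1)
    (fun k => (hmgf k a ha4).2) (n * s)).trans (Real.exp_le_exp.2 hexp)
  have hneg : ∀ k, Integrable (fun ω => Real.exp (a * (-Y k ω))) P ∧
      mgf (fun ω => -Y k ω) P a ≤ Real.exp (200 * a ^ 2) := fun k => by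
    have h := hmgf k (-a) (by rwa [abs_neg])
    simp only [mgf, neg_mul, mul_neg, neg_sq] at h ⊢
    exact h
  have hind' : iIndepFun (fun k ω => -Y k ω) P :=
    hind.comp (fun _ x => -x) (fun _ => measurable_neg)
  have h2 := (measureReal_sum_ge_le_of_mgf_le (Y := fun k ω => -Y k ω) (fun k => (hY k).neg) hind' ha0.le
    (fun k => (hneg k).1) (fun k => (hneg k).2) (n * s)).trans (Real.exp_le_exp.2 hexp)
  have hsub : {ω | s ≤ |(1 / (n : ℝ)) * ∑ k, Y k ω|} ⊆
      {ω | n * s ≤ ∑ k, Y k ω} ∪ {ω | n * s ≤ ∑ k, -Y k ω} := by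
    intro ω hω
    simp only [Set.mem_ofPred_eq, Set.mem_union, Finset.sum_neg_distrib] at hω ⊢
    rw [abs_mul, abs_of_pos (by positivity : 0 < 1 / (n : ℝ)), div_mul_eq_mul_div, one_mul,
      le_div_iff₀ hn'] at hω
    rw [mul_comm]
    exact le_abs.1 hω
  calc _ ≤ P.real ({ω | n * s ≤ ∑ k, Y k ω} ∪ {ω | n * s ≤ ∑ k, -Y k ω}) :=
        measureReal_mono hsub
    _ ≤ _ := measureReal_union_le _ _
    _ ≤ _ := by linarith

/-! ### Sums of squares by truncation -/

/-- Layer cake: the expectation is 1 + ∫ ½ exp(t/2) P(U ≥ t) dt, and the tail bound leaves 1 + ∫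
exp(-t/2) dt = 3. -/
theorem integral_exp_half_le_three {Ω : Type*} [MeasurableSpace Ω] {P : Measure Ω}
    [IsProbabilityMeasure P] {U : Ω → ℝ} (hU : Measurable U) (h0 : ∀ ω, 0 ≤ U ω)
    (htail : ∀ u, 0 < u → P.real {ω | u ≤ U ω} ≤ 2 * Real.exp (-u)) :
    Integrable (fun ω => Real.exp (U ω / 2)) P ∧ ∫ ω, Real.exp (U ω / 2) ∂P ≤ 3 := by
  refine integrable_of_lintegral_le (by fun_prop) (fun ω => (Real.exp_pos _).le) (by norm_num) ?_
  have hg : ∀ u : ℝ, ∫ t in (0 : ℝ)..u, Real.exp (t / 2) / 2 = Real.exp (u / 2) - 1 := by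
    intro u
    have hd : ∀ x ∈ Set.uIcc (0 : ℝ) u,
        HasDerivAt (fun t : ℝ => Real.exp (t / 2)) (Real.exp (x / 2) / 2) x := fun x _ => by
      simpa [div_eq_mul_inv] using ((hasDerivAt_id x).div_const 2).exp
    rw [intervalIntegral.integral_eq_sub_of_hasDerivAt hd
      (Continuous.intervalIntegrable (by fun_prop) _ _)]
    simp
  have hlc := lintegral_comp_eq_lintegral_meas_le_mul P (f := U)
    (g := fun t => Real.exp (t / 2) / 2) (Filter.Eventually.of_forall h0) hU.aemeasurable
    (fun t _ => Continuous.intervalIntegrable (by fun_prop) _ _)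
    (Filter.Eventually.of_forall fun t => by positivity)
  simp only [hg] at hlc
  have hright : ∫⁻ t in Set.Ioi (0 : ℝ), P {ω | t ≤ U ω} * ENNReal.ofReal (Real.exp (t / 2) / 2)
      ≤ ENNReal.ofReal 2 := by
    have hI : ∫ t in Set.Ioi (0 : ℝ), Real.exp (-(1 / 2) * t) = 2 := by
      rw [integral_exp_mul_Ioi (by norm_num)]; norm_num
    calc _ ≤ ∫⁻ t in Set.Ioi (0 : ℝ), ENNReal.ofReal (Real.exp (-(1 / 2) * t)) := by
          refine setLIntegral_mono (by fun_prop) fun t ht => ?_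
          rw [← ofReal_measureReal, ← ENNReal.ofReal_mul measureReal_nonneg]
          refine ENNReal.ofReal_le_ofReal ?_
          calc _ ≤ 2 * Real.exp (-t) * (Real.exp (t / 2) / 2) := by
                gcongr; exact htail t ht
            _ = Real.exp (-t) * Real.exp (t / 2) := by ring
            _ = _ := by rw [← Real.exp_add]; congr 1; ring
      _ = ENNReal.ofReal 2 := by
          rw [← ofReal_integral_eq_lintegral_ofReal (integrableOn_exp_mul_Ioi (by norm_num) 0)
            (Filter.Eventually.of_forall fun t => (Real.exp_pos _).le), hI]
  calc ∫⁻ ω, ENNReal.ofReal (Real.exp (U ω / 2)) ∂P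
      = ∫⁻ ω, (ENNReal.ofReal (Real.exp (U ω / 2) - 1) + 1) ∂P := by
        refine lintegral_congr fun ω => ?_
        have : 1 ≤ Real.exp (U ω / 2) := Real.one_le_exp (by have := h0 ω; positivity)
        rw [← ENNReal.ofReal_one, ← ENNReal.ofReal_add (by linarith) zero_le_one, sub_add_cancel]
    _ = ∫⁻ ω, ENNReal.ofReal (Real.exp (U ω / 2) - 1) ∂P + 1 := by
        rw [lintegral_add_right _ measurable_const]; simp
    _ ≤ ENNReal.ofReal 2 + ENNReal.ofReal 1 := by
        rw [hlc]; gcongr; simp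
    _ = ENNReal.ofReal 3 := by rw [← ENNReal.ofReal_add] <;> norm_num

/-- Exponential moment of the truncation of `Z²` at level `t`. -/
theorem mgf_truncated_sq_le {Ω : Type*} [MeasurableSpace Ω] {P : Measure Ω}
    [IsProbabilityMeasure P] {c : ℝ} (hc : 0 < c) (hc1 : c ≤ 1) {n : ℕ} (hn : 0 < n)
    {Z : Ω → ℝ} (hZ : Measurable Z)
    (htail : ∀ s : ℝ, 0 < s →
      P.real {ω | s ≤ |Z ω|} ≤ 2 * Real.exp (-(c * n * min s (s ^ 2))))
    {t a : ℝ} (ht : 0 < t) (ha : 0 ≤ a) (hat : a * t ≤ c / 4 * n * min t (√t)) :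
    Integrable (fun ω => Real.exp (a * (if Z ω ^ 2 < t then Z ω ^ 2 else 0))) P ∧
      mgf (fun ω => if Z ω ^ 2 < t then Z ω ^ 2 else 0) P a
        ≤ Real.exp (96 / c ^ 2 * a / n) := by
  have hn' : (1 : ℝ) ≤ n := by exact_mod_cast hn
  have hst := Real.sq_sqrt ht.le
  have hst0 : 0 < √t := Real.sqrt_pos.2 ht
  set V : Ω → ℝ := fun ω => if Z ω ^ 2 < t then Z ω ^ 2 else 0 with hV
  set U : Ω → ℝ := fun ω => c * n * min |Z ω| (|Z ω| ^ 2) with hUdef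
  have hVm : Measurable V :=
    Measurable.ite (measurableSet_lt (by fun_prop) (by fun_prop)) (by fun_prop) (by fun_prop)
  have hUm : Measurable U := by fun_prop
  have hU0 : ∀ ω, 0 ≤ U ω := fun ω => by positivity
  have hUt : ∀ u, 0 < u → P.real {ω | u ≤ U ω} ≤ 2 * Real.exp (-u) := by
    intro u hu
    set w : ℝ := u / (c * n) with hw
    have hw0 : 0 < w := by positivity
    have hcw : c * n * w = u := by rw [hw]; field_simp
    have hsw := Real.sq_sqrt hw0.le
    have hsw0 : 0 < √w := Real.sqrt_pos.2 hw0
    -- s ↦ max(s, √s) inverts s ↦ min(s, s²), so U has a standard exponential tail.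
    have hs : min (max w (√w)) (max w (√w) ^ 2) = w := by
      rcases le_total w 1 with h | h
      · have h1 : √w ≤ 1 := Real.sqrt_le_one.2 h
        have h2 : w ≤ √w := by nlinarith
        rw [max_eq_right h2, hsw, min_eq_right h2]
      · have h1 : 1 ≤ √w := Real.one_le_sqrt.2 h
        have h2 : √w ≤ w := by nlinarith
        rw [max_eq_left h2, min_eq_left (by nlinarith)]
    have := htail (max w (√w)) (lt_max_of_lt_left hw0)
    rw [hs, hcw] at this
    refine (measureReal_mono fun ω hω => ?_).trans this
    simp only [Set.mem_ofPred_eq, hUdef] at hω ⊢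
    rw [← hcw] at hω
    have h3 : w ≤ min |Z ω| (|Z ω| ^ 2) := le_of_mul_le_mul_left hω (by positivity)
    refine max_le (h3.trans (min_le_left _ _)) ?_
    exact Real.sqrt_le_iff.2 ⟨abs_nonneg _, h3.trans (min_le_right _ _)⟩
  obtain ⟨iU, bU⟩ := integral_exp_half_le_three hUm hU0 hUt
  have hV0 : ∀ ω, 0 ≤ V ω := fun ω => by
    simp only [hV]; split_ifs <;> positivity
  -- Here truncation matters: the condition on a gives a ≤ cn/4 and a√t ≤ cn/4, and az² ≤ (a√t)z
  -- when z < √t.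
  have haV : ∀ ω, a * V ω ≤ U ω / 4 := by
    intro ω
    simp only [hV, hUdef]
    split_ifs with h
    · set z := |Z ω| with hz
      have hz0 : 0 ≤ z := abs_nonneg _
      rw [← sq_abs (Z ω), ← hz] at h ⊢
      have hzs : z < √t := Real.lt_sqrt_of_sq_lt h
      have h1 : a * t ≤ c / 4 * n * t := hat.trans (by gcongr; exact min_le_left _ _)
      have h2 : a * t ≤ c / 4 * n * √t := hat.trans (by gcongr; exact min_le_right _ _)
      have h1' : a ≤ c / 4 * n := le_of_mul_le_mul_right h1 ht
      have h2' : a * √t ≤ c / 4 * n := by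
        refine le_of_mul_le_mul_right ?_ hst0
        rw [mul_assoc, ← sq, hst]; exact h2
      rcases min_cases z (z ^ 2) with ⟨h3, _⟩ | ⟨h3, _⟩ <;> rw [h3]
      · have : a * z ≤ c / 4 * n := le_trans (by gcongr) h2'
        nlinarith
      · nlinarith [sq_nonneg z]
    · have := hU0 ω
      simp only [hUdef] at this
      linarith
  -- This supplies the factor 1/n, the scale of Z². In the linear branch one has n² in place of n,
  -- and n ≥ 1 suffices.
  have hVU : ∀ ω, V ω ≤ 32 / c ^ 2 / n * Real.exp (U ω / 4) := by
    intro ω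
    have hVz : V ω ≤ |Z ω| ^ 2 := by
      simp only [hV]; rw [sq_abs]; split_ifs <;> [exact le_rfl; positivity]
    refine hVz.trans ?_
    rw [div_div, div_mul_eq_mul_div, le_div_iff₀ (by positivity)]
    set z := |Z ω| with hz
    have hz0 : 0 ≤ z := abs_nonneg _
    have hUz : U ω = c * n * min z (z ^ 2) := rfl
    rcases min_cases z (z ^ 2) with ⟨h3, _⟩ | ⟨h3, _⟩ <;> rw [h3] at hUz
    · have h4 := sq_div_two_le_exp (x := U ω / 4) (by have := hU0 ω; positivity)
      have h5 : U ω ^ 2 = c ^ 2 * n * (n * z ^ 2) := by rw [hUz]; ring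
      have h6 : z ^ 2 * (c ^ 2 * n) ≤ U ω ^ 2 := by
        rw [h5]
        have : 0 ≤ c ^ 2 * n * z ^ 2 := by positivity
        nlinarith
      nlinarith
    · have h4 := Real.add_one_le_exp (U ω / 4)
      have h5 : z ^ 2 * (c ^ 2 * n) = c * U ω := by rw [hUz]; ring
      rw [h5]
      nlinarith [hU0 ω]
  have key : ∀ ω, Real.exp (a * V ω) ≤ 1 + a * (32 / c ^ 2 / n) * Real.exp (U ω / 2) := by
    intro ω
    -- eˣ - 1 ≤ x eˣ spends one exp(U/4) on the factor V and one on exp(aV), for a total of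
    -- exp(U/2).
    have h1 : Real.exp (a * V ω) - 1 ≤ a * V ω * Real.exp (a * V ω) := by
      have := Real.add_one_le_exp (-(a * V ω))
      have h2 : Real.exp (-(a * V ω)) * Real.exp (a * V ω) = 1 := by
        rw [← Real.exp_add]; simp
      nlinarith [Real.exp_pos (a * V ω)]
    have h2 : a * V ω * Real.exp (a * V ω)
        ≤ a * (32 / c ^ 2 / n * Real.exp (U ω / 4)) * Real.exp (U ω / 4) := by
      have := hV0 ω
      gcongr
      · exact hVU ω
      · exact haV ω
    have h3 : Real.exp (U ω / 4) * Real.exp (U ω / 4) = Real.exp (U ω / 2) := by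
      rw [← Real.exp_add]; congr 1; ring
    rw [← h3]
    linarith
  have i2 : Integrable (fun ω => 1 + a * (32 / c ^ 2 / n) * Real.exp (U ω / 2)) P :=
    (integrable_const _).add (iU.const_mul _)
  have hi : Integrable (fun ω => Real.exp (a * V ω)) P := by
    refine i2.mono' (Measurable.aestronglyMeasurable (by fun_prop))
      (Filter.Eventually.of_forall fun ω => ?_)
    rw [Real.norm_of_nonneg (Real.exp_pos _).le]
    exact key ω
  refine ⟨hi, ?_⟩
  calc mgf V P a ≤ ∫ ω, (1 + a * (32 / c ^ 2 / n) * Real.exp (U ω / 2)) ∂P :=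
        integral_mono hi i2 key
    _ = 1 + a * (32 / c ^ 2 / n) * ∫ ω, Real.exp (U ω / 2) ∂P := by
        rw [integral_add (integrable_const _) (iU.const_mul _), integral_const_mul]; simp
    _ ≤ 1 + a * (32 / c ^ 2 / n) * 3 := by gcongr
    _ = 96 / c ^ 2 * a / n + 1 := by ring
    _ ≤ _ := Real.add_one_le_exp _

/-- A sum of squares of independent variables with Bernstein-type tails. -/
theorem measureReal_sum_sq_ge_le {Ω : Type*} [MeasurableSpace Ω] {P : Measure Ω}
    [IsProbabilityMeasure P] {c : ℝ} (hc : 0 < c) (hc1 : c ≤ 1) {m n : ℕ} (hm : 0 < m)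
    (hn : 0 < n) {Z : Fin m → Ω → ℝ} (hZ : ∀ l, Measurable (Z l)) (hind : iIndepFun Z P)
    (htail : ∀ l (s : ℝ), 0 < s →
      P.real {ω | s ≤ |Z l ω|} ≤ 2 * Real.exp (-(c * n * min s (s ^ 2))))
    {t : ℝ} (ht : 8 / c ^ 2 * (m / n) ≤ t) :
    P.real {ω | (96 / c ^ 2 + 1) * t ≤ ∑ l, Z l ω ^ 2}
      ≤ 3 * Real.exp (-(c / 4 * n * min t (√t))) := by
  have hn' : (1 : ℝ) ≤ n := by exact_mod_cast hn
  have hm' : (1 : ℝ) ≤ m := by exact_mod_cast hm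
  have ht0 : 0 < t := lt_of_lt_of_le (by positivity) ht
  have hst := Real.sq_sqrt ht0.le
  have hst0 : 0 < √t := Real.sqrt_pos.2 ht0
  have hnt : 8 / c ^ 2 * m ≤ n * t := by
    have h1 : 8 / c ^ 2 * (m / n) * n ≤ t * n := by gcongr
    have h2 : 8 / c ^ 2 * (m / n) * n = 8 / c ^ 2 * m := by field_simp
    linarith
  have hA : (8 : ℝ) ≤ 8 / c ^ 2 := by
    rw [le_div_iff₀ (by positivity)]; nlinarith
  have hmt : (m : ℝ) ≤ n * t := by nlinarith
  set ρ : ℝ := n * min t (√t) with hρ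
  have hρ0 : 0 < ρ := by positivity
  have hρ2 : 8 / c ^ 2 * m ≤ ρ ^ 2 := by
    rcases min_cases t (√t) with ⟨h3, _⟩ | ⟨h3, _⟩ <;> rw [hρ, h3]
    · have : 1 ≤ n * t := by linarith
      nlinarith
    · rw [mul_pow, hst]
      have : 0 ≤ n * t := by positivity
      nlinarith
  have hmexp : (m : ℝ) ≤ Real.exp (c / 2 * ρ) := by
    refine le_trans ?_ (sq_div_two_le_exp (by positivity))
    have : c ^ 2 * (8 / c ^ 2 * m) ≤ c ^ 2 * ρ ^ 2 := by gcongr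
    have h2 : c ^ 2 * (8 / c ^ 2 * m) = 8 * m := by field_simp
    nlinarith
  set a : ℝ := c / 4 * ρ / t with ha
  have ha0 : 0 ≤ a := by positivity
  have hat : a * t = c / 4 * n * min t (√t) := by rw [ha, hρ]; field_simp
  set V : Fin m → Ω → ℝ := fun l ω => if Z l ω ^ 2 < t then Z l ω ^ 2 else 0 with hV
  have hg : Measurable (fun z : ℝ => if z ^ 2 < t then z ^ 2 else 0) :=
    Measurable.ite (measurableSet_lt (by fun_prop) (by fun_prop)) (by fun_prop) (by fun_prop)
  have hVm : ∀ l, Measurable (V l) := fun l => hg.comp (hZ l)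
  have hVind : iIndepFun V P := hind.comp (fun _ z => if z ^ 2 < t then z ^ 2 else 0) fun _ => hg
  have hVmgf := fun l => mgf_truncated_sq_le hc hc1 hn (hZ l) (htail l) ht0 ha0 hat.le
  have h1 := measureReal_sum_ge_le_of_mgf_le hVm hVind ha0 (fun l => (hVmgf l).1)
    (fun l => (hVmgf l).2) ((96 / c ^ 2 + 1) * t)
  -- Since m/n ≤ t, the moment cost is at most (96/c²)at; the extra 1 in the threshold leaves
  -- exp(-at).
  have hexp : m * (96 / c ^ 2 * a / n) - a * ((96 / c ^ 2 + 1) * t) ≤ -(c / 4 * ρ) := by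
    have h2 : m * (96 / c ^ 2 * a / n) ≤ 96 / c ^ 2 * a * t := by
      rw [← mul_div_assoc, div_le_iff₀ (by positivity)]
      have : 0 ≤ 96 / c ^ 2 * a := by positivity
      nlinarith
    have h3 : c / 4 * ρ = a * t := by rw [hat, hρ]; ring
    rw [h3]; linarith
  have h1' := h1.trans (Real.exp_le_exp.2 hexp)
  have h2 : P.real (⋃ l, {ω | √t ≤ |Z l ω|}) ≤ 2 * Real.exp (-(c / 4 * ρ)) := by
    calc P.real (⋃ l, {ω | √t ≤ |Z l ω|}) ≤ ∑ l, P.real {ω | √t ≤ |Z l ω|} :=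
          measureReal_iUnion_fintype_le _
      _ ≤ ∑ _l : Fin m, 2 * Real.exp (-(c * ρ)) := by
          refine Finset.sum_le_sum fun l _ => (htail l (√t) hst0).trans ?_
          rw [hst, min_comm, mul_assoc]
      _ = m * (2 * Real.exp (-(c * ρ))) := by simp
      _ ≤ Real.exp (c / 2 * ρ) * (2 * Real.exp (-(c * ρ))) := by gcongr
      _ = 2 * Real.exp (-(c / 2 * ρ)) := by
          rw [mul_left_comm, ← Real.exp_add]; congr 2; ring
      _ ≤ 2 * Real.exp (-(c / 4 * ρ)) := by gcongr; norm_num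
  have hsub : {ω | (96 / c ^ 2 + 1) * t ≤ ∑ l, Z l ω ^ 2} ⊆
      {ω | (96 / c ^ 2 + 1) * t ≤ ∑ l, V l ω} ∪ ⋃ l, {ω | √t ≤ |Z l ω|} := by
    intro ω hω
    by_cases h : ∃ l, √t ≤ |Z l ω|
    · exact Or.inr (Set.mem_iUnion.2 h)
    · left
      push Not at h
      have : ∀ l, V l ω = Z l ω ^ 2 := fun l => by
        simp only [hV]
        rw [if_pos]
        rw [← sq_abs, ← hst]
        exact pow_lt_pow_left₀ (h l) (abs_nonneg _) two_ne_zero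
      simpa [this] using hω
  have h3 := (measureReal_mono hsub).trans (measureReal_union_le (μ := P) _ _)
  have h4 : c / 4 * n * min t (√t) = c / 4 * ρ := by rw [hρ]; ring
  rw [h4]
  linarith

/-! ### Upper bounds for the covariance errors -/

section
variable {Ω : Type*} [MeasurableSpace Ω] {P : Measure Ω} {m n p : ℕ}
  {X : Fin m → Fin n → Ω → (Fin p → ℝ)} {S : Fin m → Matrix (Fin p) (Fin p) ℝ}

theorem measurable_covErr (h : IsSubGaussianSample P X S) (i j : Fin p) (l : Fin m) :
    Measurable (covErr X S i j l) := by
  have hX := h.measurable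
  have : covErr X S i j l =
      fun ω => (1 / (n : ℝ)) * ∑ k, X l k ω i * X l k ω j - S l i j := by
    ext ω
    simp [covErr, empCov, Matrix.sum_apply, Matrix.vecMulVec_apply]
  rw [this]
  fun_prop

/-- Mean zero identifies the covariance entry with the expected product of coordinates. -/
theorem covErr_eq_mean (h : IsSubGaussianSample P X S) (hn : 0 < n) (i j : Fin p) (l : Fin m)
    (ω : Ω) :
    covErr X S i j l ω = (1 / (n : ℝ)) *
      ∑ k, (X l k ω i * X l k ω j - ∫ ω', X l k ω' i * X l k ω' j ∂P) := by
  have hn' : (n : ℝ) ≠ 0 := by positivity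
  have hS : ∀ k, ∫ ω', X l k ω' i * X l k ω' j ∂P = S l i j := fun k => by
    rw [← h.covariance_eq l k i j]
    simp [covariance, h.mean_zero]
  simp only [hS, Finset.sum_sub_distrib, Finset.sum_const, Finset.card_univ, Fintype.card_fin,
    nsmul_eq_mul]
  simp only [covErr, empCov, Matrix.smul_apply, Matrix.sum_apply, Matrix.vecMulVec_apply,
    smul_eq_mul]
  field_simp

theorem iIndepFun_covErr (h : IsSubGaussianSample P X S) (i j : Fin p) :
    iIndepFun (covErr X S i j) P := by
  have hg : ∀ l, Measurable (fun x : Fin n → Fin p → ℝ => empCov x i j - S l i j) := fun l => by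
    simp only [empCov, Matrix.smul_apply, Matrix.sum_apply, Matrix.vecMulVec_apply, smul_eq_mul]
    fun_prop
  exact (iIndepFun_curry h.measurable h.indep).comp (fun l x => empCov x i j - S l i j) hg

theorem measureReal_abs_covErr_ge_le [IsProbabilityMeasure P] (h : IsSubGaussianSample P X S)
    (hn : 0 < n) (i j : Fin p) (l : Fin m) {s : ℝ} (hs : 0 < s) :
    P.real {ω | s ≤ |covErr X S i j l ω|} ≤ 2 * Real.exp (-(1 / 800 * n * min s (s ^ 2))) := by
  have hX := h.measurable
  have hXi : ∀ k i, Measurable (fun ω => X l k ω i) := fun k i => by fun_prop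
  have hrow : iIndepFun (X l) P :=
    h.indep.precomp (g := fun k => (l, k)) (fun a b hab => (Prod.mk.inj hab).2)
  have hind : iIndepFun
      (fun k ω => X l k ω i * X l k ω j - ∫ ω', X l k ω' i * X l k ω' j ∂P) P :=
    hrow.comp (fun k x => x i * x j - ∫ ω', X l k ω' i * X l k ω' j ∂P)
      (fun k => by fun_prop)
  simp only [covErr_eq_mean h hn]
  refine measureReal_abs_mean_ge_le hn (fun k => by fun_prop) hind (fun k a ha => ?_) hs
  obtain ⟨iU, bU⟩ := integral_exp_sq_le_of_orliczNorm_le_one (hXi k i) (h.orlicz_le_one l k i)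
  obtain ⟨iV, bV⟩ := integral_exp_sq_le_of_orliczNorm_le_one (hXi k j) (h.orlicz_le_one l k j)
  obtain ⟨iW, bW⟩ := integral_exp_abs_mul_le (hXi k i) (hXi k j) iU bU iV bV
  exact mgf_sub_integral_le ((hXi k i).mul (hXi k j)) iW bW ha

theorem measurable_sumSqErr (h : IsSubGaussianSample P X S) (i j : Fin p) :
    Measurable (sumSqErr X S i j) :=
  Finset.measurable_sum _ fun l _ => (measurable_covErr h i j l).pow_const 2

theorem measureReal_sumSqErr_ge_le [IsProbabilityMeasure P] (h : IsSubGaussianSample P X S)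
    (hm : 0 < m) (hn : 0 < n) (i j : Fin p) {t : ℝ} (ht : 5120000 * ((m : ℝ) / n) ≤ t) :
    P.real {ω | 61440001 * t ≤ sumSqErr X S i j ω}
      ≤ 3 * Real.exp (-(1 / 3200 * (n * min t (√t)))) := by
  have := measureReal_sum_sq_ge_le (c := 1 / 800) (by norm_num) (by norm_num) hm hn
    (measurable_covErr h i j) (iIndepFun_covErr h i j)
    (fun l s hs => measureReal_abs_covErr_ge_le h hn i j l hs) (t := t) (by norm_num; exact ht)
  norm_num at this
  norm_num [sumSqErr]
  rwa [mul_assoc] at this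

theorem tailRate_le (m n : ℕ) (t : ℝ) : tailRate m n t ≤ n * min t (√t) := by
  rw [mul_min_of_nonneg _ _ (Nat.cast_nonneg n)]
  exact min_le_right _ _

theorem measureReal_sumSqErr_ge_le_tailRate [IsProbabilityMeasure P]
    (h : IsSubGaussianSample P X S) (hm : 0 < m) (hn : 0 < n) (i j : Fin p) {t : ℝ} (ht : 0 < t) :
    P.real {ω | t + 61440001 * 5120000 * ((m : ℝ) / n) ≤ sumSqErr X S i j ω}
      ≤ 4 * Real.exp (-(1 / (3200 * 61440001) * tailRate m n t)) := by
  have hmn : 0 ≤ (m : ℝ) / n := by positivity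
  -- With c = 1/800 one has 8/c² = 5120000 and 96/c² + 1 = 61440001. The second summand keeps u
  -- above the required floor.
  set u : ℝ := t / 61440001 + 5120000 * ((m : ℝ) / n) with hu
  have h1 := measureReal_sumSqErr_ge_le h hm hn i j (t := u)
    (by rw [hu]; linarith [div_pos ht (by norm_num : (0 : ℝ) < 61440001)])
  have h2 : t + 61440001 * 5120000 * ((m : ℝ) / n) = 61440001 * u := by rw [hu]; ring
  rw [h2]
  have hut : t / 61440001 ≤ u := by rw [hu]; linarith
  have hmin : min t (√t) / 61440001 ≤ min u (√u) := by
    refine le_min ((div_le_div_of_nonneg_right (min_le_left _ _) (by norm_num)).trans hut) ?_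
    refine (div_le_div_of_nonneg_right (min_le_right _ _) (by norm_num)).trans ?_
    refine Real.le_sqrt_of_sq_le ?_
    rw [div_pow, Real.sq_sqrt ht.le]
    refine le_trans ?_ hut
    gcongr
    norm_num
  have h3 := tailRate_le m n t
  have h4 : (n : ℝ) * (min t (√t) / 61440001) ≤ n * min u (√u) := by gcongr
  calc _ ≤ _ := h1
    _ ≤ 4 * Real.exp (-(1 / 3200 * (n * min u (√u)))) := by gcongr; norm_num
    _ ≤ _ := by
      refine mul_le_mul_of_nonneg_left (Real.exp_le_exp.2 ?_) (by norm_num)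
      rw [mul_div_assoc'] at h4
      linarith

theorem one_sub_exp_neg_le_measureReal_sumSqErr_le [IsProbabilityMeasure P]
    (h : IsSubGaussianSample P X S) (hm : 0 < m) (hn : 0 < n) (i j : Fin p) {ν : ℝ} (hν : 0 < ν) :
    1 - Real.exp (-ν) ≤ P.real {ω | sumSqErr X S i j ω ≤
      61440001 * 81920000 * ((m + √(m * ν) + ν) / n + ν ^ 2 / (n : ℝ) ^ 2)} := by
  have hn' : (1 : ℝ) ≤ n := by exact_mod_cast hn
  have hm' : (1 : ℝ) ≤ m := by exact_mod_cast hm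
  -- 81920000 = 2 · 6400², matched to (1 + ν)² ≤ 2(1 + ν²) in the √t branch. The term √(mν) is not
  -- needed and is only added at the end.
  set t : ℝ := 81920000 * ((m + ν) / n + ν ^ 2 / (n : ℝ) ^ 2) with ht
  have ht0 : 0 < t := by positivity
  have htA : 5120000 * ((m : ℝ) / n) ≤ t := by
    rw [ht]
    gcongr
    · norm_num
    · rw [add_div, add_assoc]
      exact le_add_of_nonneg_right (by positivity)
  have hnt : n * t = 81920000 * (m + ν + ν ^ 2 / n) := by rw [ht]; field_simp
  have hnnt : (n : ℝ) ^ 2 * t = 81920000 * (n * (m + ν) + ν ^ 2) := by rw [ht]; field_simp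
  have hrate : 2 * (1 + ν) ≤ 1 / 3200 * (n * min t (√t)) := by
    have h1 : 6400 * (1 + ν) ≤ n * t := by
      rw [hnt]
      have : 0 ≤ ν ^ 2 / n := by positivity
      linarith
    have h2 : 6400 * (1 + ν) ≤ n * √t := by
      refine le_of_sq_le_sq ?_ (by positivity)
      rw [mul_pow _ (√t), Real.sq_sqrt ht0.le, hnnt]
      nlinarith [sq_nonneg (1 - ν)]
    rw [mul_min_of_nonneg _ _ (by positivity)]
    have := le_min h1 h2
    linarith
  have htail : P.real {ω | 61440001 * t ≤ sumSqErr X S i j ω} ≤ Real.exp (-ν) := by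
    refine (measureReal_sumSqErr_ge_le h hm hn i j htA).trans ?_
    have h3 : (3 : ℝ) ≤ Real.exp 2 := by linarith [Real.add_one_le_exp (2 : ℝ)]
    calc _ ≤ Real.exp 2 * Real.exp (-(2 * (1 + ν))) := by gcongr
      _ = Real.exp (-(2 * ν)) := by rw [← Real.exp_add]; congr 1; ring
      _ ≤ _ := by gcongr; linarith
  have hmeas : MeasurableSet {ω | 61440001 * t ≤ sumSqErr X S i j ω} :=
    measurableSet_le measurable_const (measurable_sumSqErr h i j)
  have hcompl := probReal_compl_eq_one_sub (μ := P) hmeas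
  calc 1 - Real.exp (-ν) ≤ P.real {ω | 61440001 * t ≤ sumSqErr X S i j ω}ᶜ := by
        rw [hcompl]; linarith
    _ ≤ _ := by
      refine measureReal_mono fun ω hω => ?_
      simp only [Set.mem_compl_iff, Set.mem_ofPred_eq, not_le] at hω ⊢
      refine hω.le.trans ?_
      rw [ht, ← mul_assoc]
      gcongr
      linarith [Real.sqrt_nonneg (m * ν)]

end

/-! ### Lower bound -/

/-- If each of `m` events has probability at least `q`, then with probability at least `q / 2` a
proportion `q / 2` of them occurs; this holds without independence. -/
theorem half_le_measureReal_of_count_le {Ω : Type*} [MeasurableSpace Ω] {P : Measure Ω}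
    [IsProbabilityMeasure P] {m : ℕ} (hm : 0 < m) {E : Fin m → Set Ω}
    (hE : ∀ l, MeasurableSet (E l)) {q : ℝ} (hq0 : 0 ≤ q) (hq : ∀ l, q ≤ P.real (E l)) {f : Ω → ℝ}
    (hf : Measurable f) (hfE : ∀ ω, ∑ l, (E l).indicator (fun _ => (1 : ℝ)) ω ≤ f ω) :
    q / 2 ≤ P.real {ω | q / 2 * m ≤ f ω} := by
  have hm' : (0 : ℝ) < m := by exact_mod_cast hm
  set F : Set Ω := {ω | q / 2 * m ≤ f ω} with hF
  have hFm : MeasurableSet F := measurableSet_le measurable_const hf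
  have hone : ∀ {A : Set Ω}, MeasurableSet A →
      Integrable (A.indicator (fun _ => (1 : ℝ))) P := fun hA =>
    (integrable_const _).indicator hA
  have hint : ∀ {A : Set Ω}, MeasurableSet A →
      ∫ ω, A.indicator (fun _ => (1 : ℝ)) ω ∂P = P.real A := fun hA => by
    rw [integral_indicator_const _ hA]; simp
  -- The count is at most m on F and at most qm/2 off F; integrating gives mq ≤ qm/2 + m P(F).
  have hpt : ∀ ω, ∑ l, (E l).indicator (fun _ => (1 : ℝ)) ω
      ≤ q / 2 * m + m * F.indicator (fun _ => (1 : ℝ)) ω := by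
    intro ω
    by_cases hω : ω ∈ F
    · rw [Set.indicator_of_mem hω]
      have h1 : ∑ l, (E l).indicator (fun _ => (1 : ℝ)) ω ≤ m := by
        refine (Finset.sum_le_card_nsmul _ _ 1 fun l _ => ?_).trans (by simp)
        exact Set.indicator_le_self' (fun _ _ => zero_le_one) ω
      have h2 : 0 ≤ q / 2 * m := by positivity
      linarith
    · have h1 : f ω < q / 2 * m := not_le.1 hω
      rw [Set.indicator_of_notMem hω]
      linarith [hfE ω]
  have h1 := integral_mono (μ := P) (integrable_finsetSum _ fun l _ => hone (hE l))
    ((integrable_const _).add ((hone hFm).const_mul (m : ℝ))) hpt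
  simp only [Pi.add_apply] at h1
  rw [integral_finsetSum _ fun l _ => hone (hE l),
    integral_add (integrable_const _) ((hone hFm).const_mul (m : ℝ)),
    integral_const_mul (m : ℝ) (F.indicator fun _ => (1 : ℝ)), hint hFm] at h1
  simp only [hint (hE _), integral_const, probReal_univ, one_smul] at h1
  have h2 : m * q ≤ ∑ l, P.real (E l) := by
    simpa using Finset.card_nsmul_le_sum Finset.univ (fun l => P.real (E l)) q fun l _ => hq l
  refine le_of_mul_le_mul_left ?_ hm'
  linarith

theorem le_measureReal_sumSqErr_ge {Ω : Type*} [MeasurableSpace Ω] {P : Measure Ω}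
    [IsProbabilityMeasure P] {m n p : ℕ}
    {X : Fin m → Fin n → Ω → (Fin p → ℝ)} {S : Fin m → Matrix (Fin p) (Fin p) ℝ}
    (h : IsSubGaussianSample P X S) (hm : 0 < m) (hn : 0 < n) (i j : Fin p)
    {κ C₀ q : ℝ} (hC₀ : 0 < C₀) (hq0 : 0 < q) (hq1 : q ≤ 1)
    (hqκ : q ≤ κ * Real.exp (-C₀))
    (hlow : ∀ (l : Fin m) (t : ℝ), 0 < t →
      κ * Real.exp (-(C₀ * min (n * t) (n * t ^ 2))) ≤ P.real {ω | t ≤ |covErr X S i j l ω|})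
    {t : ℝ} (ht : 0 < t) :
    q / 2 * Real.exp (-(8 * C₀ / q * tailRate m n t))
      ≤ P.real {ω | t + q / 4 * (m / n) ≤ sumSqErr X S i j ω} := by
  have hn' : (1 : ℝ) ≤ n := by exact_mod_cast hn
  have hm' : (1 : ℝ) ≤ m := by exact_mod_cast hm
  have hκ : q ≤ κ := by
    have h1 : Real.exp (-C₀) ≤ 1 := Real.exp_le_one_iff.2 (by linarith)
    have h2 : 0 < κ := by
      by_contra hκ
      nlinarith [Real.exp_pos (-C₀)]
    nlinarith
  have hr0 : 0 ≤ tailRate m n t := by unfold tailRate; positivity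
  rcases le_total t (q / 4 * (m / n)) with htc | htc
  -- Small t: at level 1/√n the assumed tail is at least κ exp(-C₀) ≥ q, and a proportion q/2 of
  -- such errors gives a sum of (q/2)(m/n), which is at least the target.
  · have hsn : 0 < √(n : ℝ) := Real.sqrt_pos.2 (by linarith)
    have hsn2 : √(n : ℝ) ^ 2 = n := Real.sq_sqrt (by linarith)
    have hE : ∀ l, q ≤ P.real {ω | 1 / √(n : ℝ) ≤ |covErr X S i j l ω|} := by
      intro l
      refine hqκ.trans (le_trans ?_ (hlow l _ (by positivity)))
      refine mul_le_mul_of_nonneg_left (Real.exp_le_exp.2 ?_) (hq0.le.trans hκ)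
      have h1 : min (n * (1 / √(n : ℝ))) (n * (1 / √(n : ℝ)) ^ 2) ≤ 1 := by
        refine (min_le_right _ _).trans ?_
        rw [div_pow, hsn2]
        field_simp
        norm_num
      nlinarith
    have hcount := half_le_measureReal_of_count_le hm
      (fun l => measurableSet_le measurable_const (measurable_covErr h i j l).abs) hq0.le hE
      (f := fun ω => n * sumSqErr X S i j ω) ((measurable_sumSqErr h i j).const_mul _)
      (fun ω => by
        rw [sumSqErr, Finset.mul_sum]
        refine Finset.sum_le_sum fun l _ => ?_
        by_cases hx : ω ∈ {ω | 1 / √(n : ℝ) ≤ |covErr X S i j l ω|}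
        · rw [Set.indicator_of_mem hx]
          have hx' : 1 / √(n : ℝ) ≤ |covErr X S i j l ω| := hx
          have h1 := pow_le_pow_left₀ (by positivity) hx' 2
          rw [sq_abs, div_pow, hsn2, one_pow, div_le_iff₀ (by linarith)] at h1
          linarith
        · rw [Set.indicator_of_notMem hx]
          positivity)
    have hexp : Real.exp (-(8 * C₀ / q * tailRate m n t)) ≤ 1 := by
      rw [Real.exp_le_one_iff, neg_nonpos]
      positivity
    refine (mul_le_of_le_one_right (by positivity) hexp).trans
      (hcount.trans (measureReal_mono fun ω hω => ?_))
    simp only [Set.mem_ofPred_eq] at hω ⊢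
    have h1 : q / 2 * (m / n) ≤ sumSqErr X S i j ω := by
      rw [mul_div_assoc', div_le_iff₀ (by linarith)]
      linarith
    linarith
  -- Large t: n²t²/m is at least (q/4)nt, so the quadratic branch costs only a constant. One error
  -- of size √(2t) is enough, since 2t ≥ t + (q/4)(m/n).
  · have hmin0 : 0 ≤ min t (√t) := by positivity
    have hrate : q / 4 * (n * min t (√t)) ≤ tailRate m n t := by
      have h0 : n * min t (√t) ≤ n * t := by gcongr; exact min_le_left _ _
      have h1 : 0 ≤ n * min t (√t) := by positivity
      rw [tailRate, ← mul_min_of_nonneg _ _ (by linarith : (0 : ℝ) ≤ n)]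
      refine le_min ?_ (by nlinarith)
      have h2 : q / 4 * m ≤ n * t := by
        rw [mul_div_assoc', div_le_iff₀ (by linarith)] at htc
        linarith
      rw [le_div_iff₀ (by linarith)]
      calc q / 4 * (n * min t (√t)) * m = (q / 4 * m) * (n * min t (√t)) := by ring
        _ ≤ (n * t) * (n * t) := by gcongr
        _ = _ := by ring
    have hs0 : 0 < √(2 * t) := Real.sqrt_pos.2 (by positivity)
    have hs2 : √(2 * t) ^ 2 = 2 * t := Real.sq_sqrt (by positivity)
    have hmin : min (n * √(2 * t)) (n * √(2 * t) ^ 2) ≤ 2 * (n * min t (√t)) := by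
      have h1 : √(2 * t) ≤ 2 * √t := by
        refine Real.sqrt_le_iff.2 ⟨by positivity, ?_⟩
        rw [mul_pow, Real.sq_sqrt ht.le]
        linarith
      rw [hs2, ← mul_min_of_nonneg _ _ (by linarith : (0 : ℝ) ≤ n), mul_left_comm,
        mul_min_of_nonneg _ _ (by norm_num : (0 : ℝ) ≤ 2), min_comm]
      gcongr
    calc q / 2 * Real.exp (-(8 * C₀ / q * tailRate m n t))
        ≤ κ * Real.exp (-(C₀ * min (n * √(2 * t)) (n * √(2 * t) ^ 2))) := by
          refine mul_le_mul (by linarith) (Real.exp_le_exp.2 (neg_le_neg ?_))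
            (Real.exp_pos _).le (hq0.le.trans hκ)
          calc C₀ * min (n * √(2 * t)) (n * √(2 * t) ^ 2)
              ≤ C₀ * (2 * (n * min t (√t))) := by gcongr
            _ = 8 * C₀ / q * (q / 4 * (n * min t (√t))) := by field_simp; ring
            _ ≤ _ := by gcongr
      _ ≤ _ := hlow ⟨0, hm⟩ _ hs0
      _ ≤ _ := by
        refine measureReal_mono fun ω hω => ?_
        simp only [Set.mem_ofPred_eq] at hω ⊢
        have h1 := pow_le_pow_left₀ hs0.le hω 2
        rw [sq_abs, hs2] at h1
        have h2 : covErr X S i j ⟨0, hm⟩ ω ^ 2 ≤ sumSqErr X S i j ω :=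
          Finset.single_le_sum (f := fun l => covErr X S i j l ω ^ 2) (fun l _ => sq_nonneg _)
            (Finset.mem_univ _)
        linarith

theorem theorem4 :
    (∃ C c : ℝ, 0 < C ∧ 0 < c ∧
      ∀ (Ω : Type*) [MeasurableSpace Ω] (P : Measure Ω) [IsProbabilityMeasure P]
        (m n p : ℕ) (_ : 0 < m) (_ : 0 < n)
        (X : Fin m → Fin n → Ω → (Fin p → ℝ)) (S : Fin m → Matrix (Fin p) (Fin p) ℝ)
        (_ : IsSubGaussianSample P X S) (i j : Fin p) (t : ℝ) (_ : 0 < t),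
        P.real {ω | t + C * (m / n) ≤ sumSqErr X S i j ω}
          ≤ 4 * Real.exp (-(c * tailRate m n t))) ∧
    (∃ C : ℝ, 0 < C ∧
      ∀ (Ω : Type*) [MeasurableSpace Ω] (P : Measure Ω) [IsProbabilityMeasure P]
        (m n p : ℕ) (_ : 0 < m) (_ : 0 < n)
        (X : Fin m → Fin n → Ω → (Fin p → ℝ)) (S : Fin m → Matrix (Fin p) (Fin p) ℝ)
        (_ : IsSubGaussianSample P X S) (i j : Fin p) (ν : ℝ) (_ : 0 < ν),
        1 - Real.exp (-ν) ≤
          P.real {ω | sumSqErr X S i j ω ≤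
            C * ((m + Real.sqrt (m * ν) + ν) / n + ν ^ 2 / (n : ℝ) ^ 2)}) ∧
    (∀ κ C₀ : ℝ, 0 < κ → 0 < C₀ → ∃ c C : ℝ, 0 < c ∧ 0 < C ∧
      ∀ (Ω : Type*) [MeasurableSpace Ω] (P : Measure Ω) [IsProbabilityMeasure P]
        (m n p : ℕ) (_ : 0 < m) (_ : 0 < n)
        (X : Fin m → Fin n → Ω → (Fin p → ℝ)) (S : Fin m → Matrix (Fin p) (Fin p) ℝ)
        (_ : IsSubGaussianSample P X S) (i j : Fin p)
        (_ : ∀ (l : Fin m) (t : ℝ), 0 < t →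
          κ * Real.exp (-(C₀ * min (n * t) (n * t ^ 2)))
            ≤ P.real {ω | t ≤ |covErr X S i j l ω|})
        (t : ℝ) (_ : 0 < t),
        1 / C * Real.exp (-(C * tailRate m n t))
          ≤ P.real {ω | t + c * (m / n) ≤ sumSqErr X S i j ω}) := by 
  refine ⟨⟨61440001 * 5120000, 1 / (3200 * 61440001), by norm_num, by norm_num, ?_⟩,
    ⟨61440001 * 81920000, by norm_num, ?_⟩, ?_⟩
  · intro Ω _ P _ m n p hm hn X S h i j t ht
    exact measureReal_sumSqErr_ge_le_tailRate h hm hn i j ht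
  · intro Ω _ P _ m n p hm hn X S h i j ν hν
    exact one_sub_exp_neg_le_measureReal_sumSqErr_le h hm hn i j hν
  · intro κ C₀ hκ hC₀
    set q : ℝ := min (κ * Real.exp (-C₀)) 1 with hq
    have hq0 : 0 < q := lt_min (mul_pos hκ (Real.exp_pos _)) one_pos
    -- The sum serves both roles of C: 1/C ≤ q/2 in the prefactor and C ≥ 8C₀/q in the exponent.
    refine ⟨q / 4, 2 / q + 8 * C₀ / q, by positivity, by positivity, ?_⟩
    intro Ω _ P _ m n p hm hn X S h i j hlow t ht
    refine le_trans ?_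
      (le_measureReal_sumSqErr_ge h hm hn i j hC₀ hq0 (min_le_right _ _) (min_le_left _ _) hlow ht)
    have hr0 : 0 ≤ tailRate m n t := by unfold tailRate; positivity
    have h1 : 0 ≤ 8 * C₀ / q := by positivity
    have h2 : 0 < 2 / q := by positivity
    have h3 : 1 / (2 / q + 8 * C₀ / q) ≤ q / 2 := by
      rw [← one_div_div 2 q]
      exact one_div_le_one_div_of_le h2 (by linarith)
    refine mul_le_mul h3 (Real.exp_le_exp.2 ?_) (Real.exp_pos _).le (by positivity)
    nlinarith
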